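/- Let $X$ be a set of $n$ balls, each coloured with one of two colours; the colouring is unknown (and possibly only one colour occurs). For a set $Y$ of balls, a ball $x\in Y$ is a majority ball of $Y$ if more than $|Y|/2$ balls of $Y$ have the colour of $x$, and a non-minority ball of $Y$ if at least $|Y|/2$ balls of $Y$ have the colour of $x$. A majority query of size $q$ is a set $Q\subseteq X$ with $|Q|=q$; its answer is some majority ball of $Q$ (an arbitrary one, chosen adversarially), or NO if $Q$ has no majority ball. Let $MB(n,q,2)$ be the least $t$ such that some deterministic adaptive strategy asking only majority queries of size $q$ asks at most $t$ queries and then names a non-minority ball of $X$, for every colouring of $X$ and for all admissible answers ($MB(n,q,2)=\infty$ if there is no such $t$). Then for every integer $k\ge 1$ we have $MB(n,2k+1,2)=O_k(n)$; that is, there are constants $K=K(k)$ and $n_0=n_0(k)$ such that $MB(n,2k+1,2)\le Kn$ for all $n\ge n_0$. -/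

import Mathlib

namespace MajorityProblem

/-- The number of balls in `X` having the colour of `x`. -/
def colorCount {α γ : Type} [DecidableEq γ] (col : α → γ) (X : Finset α) (x : α) : ℕ :=
  (X.filter fun y => col y = col x).card

/-- `x ∈ X` is a majority ball of `X`: more than `|X|/2` balls of `X` have its colour. -/
def IsMajorityBall {α γ : Type} [DecidableEq γ] (col : α → γ) (X : Finset α) (x : α) : Prop :=
  x ∈ X ∧ (X.card : ℚ) / 2 < colorCount col X x

/-- `x ∈ X` is a non-minority ball of `X`: at least `|X|/2` balls of `X` have its colour. -/
def IsNonMinorityBall {α γ : Type} [DecidableEq γ] (col : α → γ) (X : Finset α) (x : α) : Prop :=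
  x ∈ X ∧ (X.card : ℚ) / 2 ≤ colorCount col X x

/-- The admissible answers to the majority query `Q`: `some x` (YES, together with the ball `x`)
for any majority ball `x` of `Q`, and `none` (NO) if `Q` has no majority ball. -/
def IsMajorityAnswer {α γ : Type} [DecidableEq γ] (col : α → γ) (Q : Finset α) :
    Option α → Prop
  | some x => IsMajorityBall col Q x
  | none => ∀ x, ¬ IsMajorityBall col Q x

/-- The correct final outputs: `some x` for a non-minority ball `x` of `X`, and `none` if `X` has
no non-minority ball. -/
def IsCorrectOutput {α γ : Type} [DecidableEq γ] (col : α → γ) (X : Finset α) :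
    Option α → Prop
  | some x => IsNonMinorityBall col X x
  | none => ∀ x, ¬ IsNonMinorityBall col X x

/-- Deterministic adaptive query strategies: either stop with an output, or ask a query `Q` and
continue in a way that depends on the answer. -/
inductive Strategy (α : Type) : Type
  | output (r : Option α) : Strategy α
  | ask (Q : Finset α) (next : Option α → Strategy α) : Strategy α

/-- Every query of the strategy is a set of exactly `q` balls. -/
def Strategy.HasQuerySize {α : Type} (q : ℕ) : Strategy α → Prop
  | .output _ => True
  | .ask Q next => Q.card = q ∧ ∀ a, (next a).HasQuerySize q

/-- `Run col s m r`: if the hidden colouring is `col`, then some sequence of admissible answers to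
the majority queries of `s` makes `s` ask exactly `m` queries and stop with output `r`. -/
inductive Run {α γ : Type} [DecidableEq γ] (col : α → γ) : Strategy α → ℕ → Option α → Prop
  | output (r : Option α) : Run col (.output r) 0 r
  | ask (Q : Finset α) (next : Option α → Strategy α) (a : Option α) (m : ℕ) (r : Option α)
      (ha : IsMajorityAnswer col Q a) (h : Run col (next a) m r) :
      Run col (.ask Q next) (m + 1) r

/-- With at most `t` majority queries of size `q` one can always find a non-minority ball among
`n` balls coloured with (at most) `c` colours, or show that there is none: a single strategy
succeeds for every colouring and for all admissible answers. -/
def SolvableWithin (n q c t : ℕ) : Prop :=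
  ∃ s : Strategy (Fin n), s.HasQuerySize q ∧
    ∀ (col : Fin n → Fin c) (m : ℕ) (r : Option (Fin n)), Run col s m r →
      m ≤ t ∧ IsCorrectOutput col Finset.univ r

/-- `MB n q c` is the least number of majority queries of size `q` that suffice in the worst case
to find a non-minority ball among `n` balls with `c` colours (`⊤` if no strategy succeeds). -/
noncomputable def MB (n q c : ℕ) : ℕ∞ :=
  ⨅ (t : ℕ) (_ : SolvableWithin n q c t), (t : ℕ∞)

end MajorityProblem

/-! A state of knowledge is the set of colourings compatible with the answers so far. Keep a set `S`
of `2k` balls, and again and again add a new ball and set aside the answer: in the end `S` is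
balanced, or all balls of `W = X \ S` have one colour (`Reach.balanced`). Guess which half of `S`
has colour 1. Under a guess, `S` is a reference set with which two queries on `x, y ∈ W` yield `x ≤
y`, `y ≤ x` or `x ≠ y` as colours (`Reach.compare`). Without the third outcome, median-of-medians
selection would find a median of `W` in linear time; the balls below it or those above it, more than
half of `W`, then share its colour. A pair known to differ is compared with all other balls: each
ball either becomes a function of the colour of the pair, or it reveals that colour and hence the
colours of all balls scanned, which pays for the scan (`Reach.scan`, `Amort.select`).

All guesses together give boundedly many subsets of `W`, each more than half of it, one of them
monochromatic whatever the colouring. By Dickson's lemma some odd sample `R ⊆ W` of bounded size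
contains a majority from each of them (`exists_sample`), so a majority ball of `R` is one of `W`,
and then of `X`. A query on `R` is simulated by smaller ones (`Reach.maj`): majority balls of all
sets `R` minus a pair suffice to name one of `R` (`exists_maj_of_pairs`). -/

namespace MajorityProblem

/-! ### Narrowing sets of colourings by queries -/

variable {α : Type}

/-- Integral form of `IsMajorityBall`. -/
def Maj (c : α → Fin 2) (Q : Finset α) (x : α) : Prop :=
  x ∈ Q ∧ Q.card < 2 * (Q.filter fun y => c y = c x).card

theorem card_filter_color_add (c : α → Fin 2) (Q : Finset α) (a b : Fin 2) (hab : a ≠ b) :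
    (Q.filter fun y => c y = a).card + (Q.filter fun y => c y = b).card = Q.card := by
  rw [← Finset.card_filter_add_card_filter_not (s := Q) (fun y => c y = a)]
  congr 2
  ext y
  simp only [Finset.mem_filter]
  exact and_congr_right fun _ => by omega

/-- The set `A` of colourings still possible can be narrowed down with at most `t` majority
queries of size `q`, whatever the answers are, to a set satisfying `Φ`. -/
def Reach (q : ℕ) : ℕ → (Set (α → Fin 2) → Prop) → Set (α → Fin 2) → Prop
  | 0, Φ, A => Φ A
  | t + 1, Φ, A => Φ A ∨ ∃ Q : Finset α, Q.card = q ∧ ∀ x ∈ Q, Reach q t Φ (A ∩ {c | Maj c Q x})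

namespace Reach

variable {q t t' : ℕ} {Φ Ψ : Set (α → Fin 2) → Prop} {A : Set (α → Fin 2)}

theorem of_holds (h : Φ A) : Reach q t Φ A := by
  cases t with
  | zero => exact h
  | succ t => exact Or.inl h

theorem ask (Q : Finset α) (hQ : Q.card = q)
    (h : ∀ x ∈ Q, Reach q t Φ (A ∩ {c | Maj c Q x})) : Reach q (t + 1) Φ A :=
  Or.inr ⟨Q, hQ, h⟩

theorem bind (h : Reach q t Φ A) (h' : ∀ A' ⊆ A, Φ A' → Reach q t' Ψ A') :
    Reach q (t + t') Ψ A := by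
  induction t generalizing A with
  | zero => simpa using h' A subset_rfl h
  | succ t ih =>
    -- Needed when the first phase stops early and leaves part of its budget unspent.
    have key : ∀ s, ∀ B, Reach q t' Ψ B → Reach q (t' + s) Ψ B := by
      clear ih h' h
      induction t' with
      | zero => intro s B hB; exact of_holds hB
      | succ t' ih =>
        intro s B hB
        rw [Nat.succ_add_eq_add_succ, Nat.add_succ]
        rcases hB with hB | ⟨Q, hQ, hB⟩
        · exact Or.inl hB
        · exact Or.inr ⟨Q, hQ, fun x hx => ih s _ (hB x hx)⟩
    rcases h with h | ⟨Q, hQ, h⟩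
    · rw [add_comm]; exact key _ _ (h' A subset_rfl h)
    · rw [Nat.add_right_comm]
      exact ask Q hQ fun x hx => ih (h x hx) fun A' hA' => h' A' (hA'.trans Set.inter_subset_left)

theorem mono_time (h : Reach q t Φ A) (ht : t ≤ t') : Reach q t' Φ A := by
  obtain ⟨s, rfl⟩ := Nat.exists_eq_add_of_le ht
  exact h.bind fun _ _ h => of_holds h

theorem imp (h : Reach q t Φ A) (himp : ∀ A' ⊆ A, Φ A' → Ψ A') : Reach q t Ψ A :=
  h.bind (t' := 0) himp

/-- Knowledge acquired under a hypothesis `H` on the colouring. -/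
theorem restrict {H : Set (α → Fin 2)} (h : Reach q t Φ (A ∩ H)) :
    Reach q t (fun A' => Φ (A' ∩ H)) A := by
  induction t generalizing A with
  | zero => exact h
  | succ t ih =>
    rcases h with h | ⟨Q, hQ, h⟩
    · exact Or.inl h
    · refine ask Q hQ fun x hx => ih ?_
      rw [Set.inter_right_comm]
      exact h x hx

/-- The goals are pursued one after another; antitonicity keeps those already reached while the set
of colourings shrinks. -/
theorem forall_mem {ι : Type} {I : Finset ι} {Φ : ι → Set (α → Fin 2) → Prop}
    (hΦ : ∀ i, Antitone (Φ i)) (h : ∀ i ∈ I, ∀ A' ⊆ A, Reach q t (Φ i) A') :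
    Reach q (I.card * t) (fun A' => ∀ i ∈ I, Φ i A') A := by
  classical
  induction I using Finset.induction_on with
  | empty => exact of_holds (by simp)
  | insert i I hi ih =>
    rw [Finset.card_insert_of_notMem hi, add_mul, one_mul]
    refine (ih fun j hj => h j (Finset.mem_insert_of_mem hj)).bind fun A' hA' hI => ?_
    refine (h i (Finset.mem_insert_self _ _) A' hA').imp fun B hB hiB j hj => ?_
    rcases Finset.mem_insert.1 hj with rfl | hj
    · exact hiB
    · exact hΦ j hB (hI j hj)

end Reach

theorem isMajorityBall_iff (c : α → Fin 2) (Q : Finset α) (x : α) :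
    IsMajorityBall c Q x ↔ Maj c Q x := by
  unfold IsMajorityBall Maj colorCount
  rw [div_lt_iff₀ (by norm_num), mul_comm]
  norm_cast

/-- A way to narrow down the colouring is turned into a strategy. -/
theorem Reach.exists_strategy {q t : ℕ} {X : Finset α} {A : Set (α → Fin 2)}
    (h : Reach q t (fun A => ∃ x, ∀ c ∈ A, IsNonMinorityBall c X x) A) (hq : Odd q) :
    ∃ s : Strategy α, s.HasQuerySize q ∧ ∀ c ∈ A, ∀ m r, Run c s m r →
      m ≤ t ∧ IsCorrectOutput c X r := by
  induction t generalizing A with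
  | zero =>
    obtain ⟨x, hx⟩ := h
    refine ⟨.output (some x), trivial, fun c hc m r hr => ?_⟩
    cases hr
    exact ⟨le_rfl, hx c hc⟩
  | succ t ih =>
    rcases h with ⟨x, hx⟩ | ⟨Q, hQ, h⟩
    · refine ⟨.output (some x), trivial, fun c hc m r hr => ?_⟩
      cases hr
      exact ⟨Nat.zero_le _, hx c hc⟩
    · have : Inhabited (Strategy α) := ⟨.output none⟩
      choose! s hs hs' using fun x hx => ih (h x hx)
      classical
      refine ⟨.ask Q fun a => match a with
        | none => .output none
        | some x => if x ∈ Q then s x else .output none, ⟨hQ, ?_⟩, fun c hc m r hr => ?_⟩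
      · rintro (_ | x)
        · trivial
        · by_cases hx : x ∈ Q
          · simpa [hx] using hs x hx
          · simp [hx, Strategy.HasQuerySize]
      · cases hr with
        | ask Q next a m r ha hr =>
        cases a with
        | none =>
          -- An odd query on two colours always has a majority, so NO is inadmissible.
          exfalso
          have hcount := card_filter_color_add c Q 0 1 (by decide)
          have hno : ∀ b : Fin 2, ¬ Q.card < 2 * (Q.filter fun y => c y = b).card := by
            intro b hb
            obtain ⟨y, hy⟩ := Finset.card_pos.1 (show 0 < (Q.filter fun y => c y = b).card by omega)
            rw [Finset.mem_filter] at hy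
            refine ha y ((isMajorityBall_iff c Q y).2 ⟨hy.1, ?_⟩)
            rwa [hy.2]
          obtain ⟨j, hj⟩ := hq
          have h0 := hno 0
          have h1 := hno 1
          omega
        | some x =>
          have hx := (isMajorityBall_iff c Q x).1 ha
          simp only [hx.1, if_true] at hr
          obtain ⟨h1, h2⟩ := hs' x hx.1 c ⟨hc, hx⟩ m r hr
          exact ⟨by omega, h2⟩

/-! ### Simulating larger majority queries -/

theorem Maj.card_lt {c : α → Fin 2} {Q : Finset α} {x : α} (h : Maj c Q x) {b : Fin 2}
    (hb : Q.card < 2 * (Q.filter fun y => c y = b).card) : c x = b := by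
  by_contra hne
  have := card_filter_color_add c Q _ _ hne
  have := h.2
  omega

theorem Maj.of_color {c : α → Fin 2} {Q : Finset α} {x : α} (hx : x ∈ Q)
    (hb : Q.card < 2 * (Q.filter fun y => c y = c x).card) : Maj c Q x := ⟨hx, hb⟩

/-- Let `T` have `2 * m + 3` elements and let `L u v` be a majority ball of `T \ {u, v}` for all
colourings in `A`. Then some ball is a majority ball of `T` for all colourings in `A`. -/
theorem exists_maj_of_pairs [DecidableEq α] {m : ℕ} (hm : 1 ≤ m) {T : Finset α}
    (hT : T.card = 2 * m + 3) {A : Set (α → Fin 2)} (L : α → α → α)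
    (hL : ∀ u ∈ T, ∀ v ∈ T, u ≠ v → ∀ c ∈ A, Maj c ((T.erase u).erase v) (L u v)) :
    ∃ x ∈ T, ∀ c ∈ A, Maj c T x := by
  classical
  by_cases hA : A.Nonempty
  swap
  · obtain ⟨x, hx⟩ := Finset.card_pos.1 (show 0 < T.card by omega)
    exact ⟨x, hx, fun c hc => (hA ⟨c, hc⟩).elim⟩
  -- Regard `L` as an edge labelling of the complete graph on `T`. The label of `uv` is in the
  -- minority exactly if the majority class has the least size `m + 2` and contains both `u` and
  -- `v`. If every ball can be in the minority, each label class turns out to be the edge set of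
  -- such a clique, and cliques of `m + 2` among `2 * m + 3` points cannot partition the edges.
  by_contra hno
  push Not at hno
  -- the majority class
  let M : (α → Fin 2) → Finset α := fun c => T.filter fun x => Maj c T x
  have hMsub : ∀ c, M c ⊆ T := fun c => Finset.filter_subset _ _
  have hcol : ∀ c, ∃ b, M c = T.filter fun x => c x = b := by
    intro c
    have h01 := card_filter_color_add c T 0 1 (by decide)
    obtain ⟨b, hb⟩ : ∃ b, T.card < 2 * (T.filter fun y => c y = b).card := by
      by_contra hcon
      push Not at hcon
      have := hcon 0
      have := hcon 1
      omega
    refine ⟨b, ?_⟩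
    ext x
    simp only [M, Finset.mem_filter]
    refine and_congr_right fun hx => ⟨fun h => h.card_lt hb, fun h => .of_color hx (h ▸ hb)⟩
  have hMcard : ∀ c, m + 2 ≤ (M c).card := by
    intro c
    obtain ⟨b, hb⟩ := hcol c
    obtain ⟨x, hx⟩ : (M c).Nonempty := by
      by_contra hemp
      rw [Finset.not_nonempty_iff_eq_empty] at hemp
      have h01 := card_filter_color_add c T b (1 - b) (by omega)
      rw [← hb, hemp, Finset.card_empty] at h01
      obtain ⟨x, hx⟩ := Finset.card_pos.1
        (show 0 < (T.filter fun y => c y = 1 - b).card by omega)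
      rw [Finset.mem_filter] at hx
      have : x ∈ M c := by
        simp only [M, Finset.mem_filter]
        refine ⟨hx.1, .of_color hx.1 ?_⟩
        rw [hx.2]; omega
      simp [hemp] at this
    have hx' := (Finset.mem_filter.1 hx).2.2
    have hxb : c x = b := by rw [hb, Finset.mem_filter] at hx; exact hx.2
    rw [hxb, ← hb] at hx'
    omega
  -- labels
  have hlab : ∀ c ∈ A, ∀ u ∈ T, ∀ v ∈ T, u ≠ v →
      (L u v ∉ M c ↔ (M c).card = m + 2 ∧ u ∈ M c ∧ v ∈ M c) := by
    intro c hc u hu v hv huv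
    have hl := hL u hu v hv huv c hc
    obtain ⟨b, hb⟩ := hcol c
    have hlT : L u v ∈ T := Finset.mem_of_mem_erase (Finset.mem_of_mem_erase hl.1)
    have hmem : ∀ x ∈ T, (x ∈ M c ↔ c x = b) := by
      intro x hx; rw [hb, Finset.mem_filter]; simp [hx]
    have hcard : ((T.erase u).erase v).card = 2 * m + 1 := by
      rw [Finset.card_erase_of_mem (Finset.mem_erase.2 ⟨huv.symm, hv⟩),
        Finset.card_erase_of_mem hu]; omega
    have hfil : ((T.erase u).erase v).filter (fun y => c y = b) = ((M c).erase u).erase v := by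
      ext x; simp only [hb, Finset.mem_filter, Finset.mem_erase]; tauto
    have h01 := card_filter_color_add c ((T.erase u).erase v) b (1 - b) (by omega)
    have hmaj : L u v ∈ M c ↔ m + 1 ≤ (((M c).erase u).erase v).card := by
      rw [hmem _ hlT, ← hfil]
      constructor
      · intro h
        have := hl.2
        rw [h] at this
        omega
      · intro h
        exact hl.card_lt (by omega)
    have h2 := hMcard c
    rw [hmaj, Finset.card_erase_eq_ite, Finset.card_erase_eq_ite]
    simp only [Finset.mem_erase]
    by_cases hu' : u ∈ M c <;> by_cases hv' : v ∈ M c <;> simp [hu', hv', huv.symm] <;> omega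
  have hLT : ∀ u ∈ T, ∀ v ∈ T, u ≠ v → L u v ∈ T := by
    intro u hu v hv huv
    obtain ⟨c, hc⟩ := hA
    exact Finset.mem_of_mem_erase (Finset.mem_of_mem_erase (hL u hu v hv huv c hc).1)
  have hbad : ∀ x ∈ T, ∃ c ∈ A, x ∉ M c := by
    intro x hx
    obtain ⟨c, hc, h⟩ := hno x hx
    exact ⟨c, hc, by simp [M, h]⟩
  let IsLab : α → Prop := fun z => ∃ u ∈ T, ∃ v ∈ T, u ≠ v ∧ L u v = z
  have hlabT : ∀ z, IsLab z → z ∈ T := by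
    rintro z ⟨u, hu, v, hv, huv, rfl⟩
    exact hLT u hu v hv huv
  -- a label is distinct from its ends
  have hne : ∀ u ∈ T, ∀ v ∈ T, u ≠ v → L u v ≠ u := by
    intro u hu v hv huv he
    obtain ⟨c, hc, h⟩ := hbad _ (hLT u hu v hv huv)
    have := (hlab c hc u hu v hv huv).1 h
    exact h (by rw [he]; exact this.2.1)
  -- Choose a colouring in which the label of the edge from `u` to `L u v` is in the minority: both
  -- ends are then in the majority, and `v ∈ M c` would expel `L u v`.
  have hanti : ∀ u v, IsLab u → IsLab v → u ≠ v → ∃ c ∈ A, u ∈ M c ∧ v ∉ M c := by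
    intro u v hu hv huv
    have hu := hlabT u hu
    have hv := hlabT v hv
    have hl := hLT u hu v hv huv
    have hul := (hne u hu v hv huv).symm
    obtain ⟨c, hc, h⟩ := hbad _ (hLT u hu _ hl hul)
    have h1 := (hlab c hc u hu _ hl hul).1 h
    refine ⟨c, hc, h1.2.1, fun hvM => ?_⟩
    exact (hlab c hc u hu v hv huv).2 ⟨h1.1, h1.2.1, hvM⟩ h1.2.2
  have hinv : ∀ u v, IsLab u → IsLab v → u ≠ v → L u (L u v) = v := by
    intro u v hu hv huv
    by_contra hcon
    have huT := hlabT u hu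
    have hvT := hlabT v hv
    have hl := hLT u huT v hvT huv
    have hul := (hne u huT v hvT huv).symm
    obtain ⟨c, hc, hvM, h⟩ := hanti v (L u (L u v)) hv ⟨u, huT, _, hl, hul, rfl⟩ (Ne.symm hcon)
    have h1 := (hlab c hc u huT _ hl hul).1 h
    exact (hlab c hc u huT v hvT huv).2 ⟨h1.1, h1.2.1, hvM⟩ h1.2.2
  -- at most one label is in the minority
  have huniq : ∀ c ∈ A, ∀ u v, IsLab u → IsLab v → u ∉ M c → v ∉ M c → u = v := by
    intro c hc u v hu hv huM hvM
    by_contra huv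
    have huT := hlabT u hu
    have hvT := hlabT v hv
    have hl := hLT u huT v hvT huv
    have hul := (hne u huT v hvT huv).symm
    rw [← hinv u v hu hv huv] at hvM
    exact huM ((hlab c hc u huT _ hl hul).1 hvM).2.1
  -- majority classes are cliques with equal labels
  have hclique : ∀ u ∈ T, ∀ v ∈ T, u ≠ v → ∃ c ∈ A, (M c).card = m + 2 ∧ u ∈ M c ∧ v ∈ M c ∧
      ∀ u' ∈ T, ∀ v' ∈ T, u' ≠ v' → ((u' ∈ M c ∧ v' ∈ M c) ↔ L u' v' = L u v) := by
    intro u hu v hv huv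
    obtain ⟨c, hc, h⟩ := hbad _ (hLT u hu v hv huv)
    have h1 := (hlab c hc u hu v hv huv).1 h
    refine ⟨c, hc, h1.1, h1.2.1, h1.2.2, fun u' hu' v' hv' huv' => ⟨fun h2 => ?_, fun h2 => ?_⟩⟩
    · exact huniq c hc _ _ ⟨u', hu', v', hv', huv', rfl⟩ ⟨u, hu, v, hv, huv, rfl⟩
        ((hlab c hc u' hu' v' hv' huv').2 ⟨h1.1, h2⟩) h
    · exact ((hlab c hc u' hu' v' hv' huv').1 (h2 ▸ h)).2
  obtain ⟨u, hu, v, hv, huv⟩ := Finset.one_lt_card.1 (show 1 < T.card by omega)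
  obtain ⟨c₁, -, hc₁, -, -, h₁⟩ := hclique u hu v hv huv
  obtain ⟨a, ha, a', ha', haa'⟩ := Finset.one_lt_card.1 (show 1 < (M c₁).card by omega)
  have hNcard : (T \ M c₁).card = m + 1 := by
    rw [Finset.card_sdiff_of_subset (hMsub c₁)]; omega
  obtain ⟨b, hb, b', hb', hbb'⟩ := Finset.one_lt_card.1 (show 1 < (T \ M c₁).card by omega)
  have hb2 := Finset.mem_sdiff.1 hb
  have hb2' := Finset.mem_sdiff.1 hb'
  -- The clique of `ab` meets `M c₁` only in `a`; its other `m + 1` points fill the complement,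
  -- which thus lies in it along with the edge `bb'`.
  have hcross : ∀ a ∈ M c₁, L a b = L b b' := by
    intro a ha
    have haT := hMsub _ ha
    have hab : a ≠ b := fun h => hb2.2 (h ▸ ha)
    obtain ⟨c₂, -, hc₂, ha₂, hb₂, h₂⟩ := hclique a haT b hb2.1 hab
    have hinter : M c₁ ∩ M c₂ ⊆ {a} := by
      intro x hx
      rw [Finset.mem_inter] at hx
      by_contra hxa
      rw [Finset.mem_singleton] at hxa
      have e1 := (h₁ x (hMsub _ hx.1) a haT hxa).1 ⟨hx.1, ha⟩
      have e2 := (h₂ x (hMsub _ hx.1) a haT hxa).1 ⟨hx.2, ha₂⟩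
      exact hb2.2 ((h₁ a haT b hb2.1 hab).2 (e2.symm.trans e1)).2
    have hsub : T \ M c₁ ⊆ M c₂ := by
      have hsub' : M c₂ \ M c₁ ⊆ T \ M c₁ := Finset.sdiff_subset_sdiff (hMsub _) subset_rfl
      have hcard := Finset.card_sdiff_add_card_inter (M c₂) (M c₁)
      have hle := Finset.card_le_card hinter
      rw [Finset.card_singleton, Finset.inter_comm] at hle
      have heq := Finset.eq_of_subset_of_card_le hsub' (by omega)
      rw [← heq]
      exact Finset.sdiff_subset
    exact ((h₂ b hb2.1 b' hb2'.1 hbb').1 ⟨hsub hb, hsub hb'⟩).symm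
  have haT := hMsub _ ha
  have haT' := hMsub _ ha'
  have hab : a ≠ b := fun h => hb2.2 (h ▸ ha)
  have hab' : a' ≠ b := fun h => hb2.2 (h ▸ ha')
  -- Now `ab` and `a'b` have the same label, so their clique shares the edge `aa'` with `M c₁` and
  -- would have to equal it, although `b ∉ M c₁`.
  obtain ⟨c₂, -, -, ha₂, hb₂, h₂⟩ := hclique a haT b hb2.1 hab
  have h3 := (h₂ a' haT' b hb2.1 hab').2 ((hcross a' ha').trans (hcross a ha).symm)
  have e1 := (h₁ a haT a' haT' haa').1 ⟨ha, ha'⟩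
  have e2 := (h₂ a haT a' haT' haa').1 ⟨ha₂, h3.1⟩
  exact hb2.2 ((h₁ a haT b hb2.1 hab).2 (e2.symm.trans e1)).2

/-- The number of queries of size `2 * k + 1` used to simulate one of size `2 * (k + j) + 1`. -/
def majCost (k : ℕ) : ℕ → ℕ
  | 0 => 1
  | j + 1 => (2 * (k + (j + 1)) + 1) * (2 * (k + (j + 1)) + 1) * majCost k j

/-- Majority queries of every larger odd size can be simulated. -/
theorem Reach.maj [DecidableEq α] {k : ℕ} (hk : 1 ≤ k) (j : ℕ) (R : Finset α)
    (hR : R.card = 2 * (k + j) + 1) (A : Set (α → Fin 2)) :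
    Reach (2 * k + 1) (majCost k j) (fun A => ∃ x ∈ R, ∀ c ∈ A, Maj c R x) A := by
  induction j generalizing R A with
  | zero =>
    exact Reach.ask R hR fun x hx => ⟨x, hx, fun c hc => hc.2⟩
  | succ j hC =>
    have hall := Reach.forall_mem (q := 2 * k + 1) (A := A) (t := majCost k j) (I := R ×ˢ R)
      (Φ := fun p A => p.1 ∈ R → p.2 ∈ R → p.1 ≠ p.2 →
        ∃ x, ∀ c ∈ A, Maj c ((R.erase p.1).erase p.2) x) ?_ ?_
    · rw [Finset.card_product, hR] at hall
      refine hall.imp fun A' hA' h => ?_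
      have : ∀ u v, ∃ x, u ∈ R → v ∈ R → u ≠ v → ∀ c ∈ A', Maj c ((R.erase u).erase v) x := by
        intro u v
        by_cases huv : u ∈ R ∧ v ∈ R ∧ u ≠ v
        · obtain ⟨x, hx⟩ := h (u, v) (Finset.mk_mem_product huv.1 huv.2.1) huv.1 huv.2.1 huv.2.2
          exact ⟨x, fun _ _ _ => hx⟩
        · exact ⟨u, fun h1 h2 h3 => (huv ⟨h1, h2, h3⟩).elim⟩
      choose L hL using this
      exact exists_maj_of_pairs (m := k + j) (by omega) (by omega) L
        fun u hu v hv huv => hL u v hu hv huv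
    · intro p A₁ A₂ hsub h h1 h2 h3
      obtain ⟨x, hx⟩ := h h1 h2 h3
      exact ⟨x, fun c hc => hx c (hsub hc)⟩
    · intro p hp A' hA'
      by_cases h3 : p.1 ≠ p.2
      · rw [Finset.mem_product] at hp
        refine (hC ((R.erase p.1).erase p.2) ?_ A').imp fun B _ hB _ _ _ => ?_
        · rw [Finset.card_erase_of_mem (Finset.mem_erase.2 ⟨h3.symm, hp.2⟩),
            Finset.card_erase_of_mem hp.1]
          omega
        · obtain ⟨x, -, hx⟩ := hB
          exact ⟨x, hx⟩
      · exact Reach.of_holds fun _ _ h => (h3 h).elim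

/-! ### Isolating a balanced reference set -/

/-- Setting aside the answer of a query again and again leaves a set `S` of `2 * k` balls which is
balanced, unless all balls set aside have the same colour. -/
theorem Reach.peel [DecidableEq α] {k : ℕ} (S₀ Y : Finset α) (hS₀ : S₀.card = 2 * k)
    (hd : Disjoint S₀ Y) (A : Set (α → Fin 2)) :
    Reach (2 * k + 1) Y.card (fun A => ∃ S ⊆ S₀ ∪ Y, S.card = 2 * k ∧ ∀ c ∈ A, ∃ b,
      (S.filter fun x => c x = b).card ≤ k ∧ ((S.filter fun x => c x = b).card < k →
        ∀ x ∈ (S₀ ∪ Y) \ S, c x ≠ b)) A := by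
  induction Y using Finset.induction_on generalizing A with
  | empty =>
    refine Reach.of_holds ⟨S₀, by simp, hS₀, fun c hc => ?_⟩
    have h01 := card_filter_color_add c S₀ 0 1 (by decide)
    by_cases h : (S₀.filter fun x => c x = 0).card ≤ k
    · exact ⟨0, h, by simp⟩
    · exact ⟨1, by omega, by simp⟩
  | insert y Y hy ih =>
    rw [Finset.disjoint_insert_right] at hd
    rw [Finset.card_insert_of_notMem hy]
    refine (ih hd.2 A).bind fun A' _ ⟨S, hS, hcard, h⟩ => ?_
    have hyS : y ∉ S := fun h => by
      rcases Finset.mem_union.1 (hS h) with h | h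
      · exact hd.1 h
      · exact hy h
    have hQ : (insert y S).card = 2 * k + 1 := by rw [Finset.card_insert_of_notMem hyS, hcard]
    refine Reach.ask (t := 0) (insert y S) hQ fun a ha => ?_
    refine ⟨(insert y S).erase a, ?_, ?_, fun c ⟨hc, hmaj⟩ => ?_⟩
    · intro x hx
      have := Finset.mem_of_mem_erase hx
      rw [Finset.mem_insert] at this
      rcases this with rfl | hx
      · simp
      · have := hS hx
        simp only [Finset.mem_union, Finset.mem_insert] at this ⊢
        tauto
    · rw [Finset.card_erase_of_mem ha, hQ]; rfl
    · obtain ⟨b, hb, hb'⟩ := h c hc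
      have hmaj : Maj c (insert y S) a := hmaj
      -- the number of balls of the minority colour
      have hcol : ∀ b, c a ≠ b → (((insert y S).erase a).filter fun x => c x = b)
          = (insert y S).filter fun x => c x = b := by
        intro b hab
        ext x
        simp only [Finset.mem_filter, Finset.mem_erase]
        constructor
        · rintro ⟨⟨h1, h2⟩, h3⟩; exact ⟨h2, h3⟩
        · rintro ⟨h2, h3⟩; exact ⟨⟨fun h => hab (h ▸ h3), h2⟩, h3⟩
      have hsum : ∀ b b' : Fin 2, b ≠ b' → _ := fun b b' hbb =>
        card_filter_color_add c (insert y S) b b' hbb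
      have hins : ∀ b, ((insert y S).filter fun x => c x = b).card =
          (S.filter fun x => c x = b).card + if c y = b then 1 else 0 := by
        intro b
        rw [Finset.filter_insert]
        split_ifs with hyb
        · rw [Finset.card_insert_of_notMem (by simp [hyS])]
        · rfl
      have hmc := hmaj.2
      rw [hQ] at hmc
      -- If the answer has colour `b`, then `S` had exactly `k` balls of colour `b` and `y` is
      -- another, so removing the answer leaves `k` of each. Otherwise no ball of colour `b` is set
      -- aside, and its count in `S` does not decrease.
      by_cases hab : c a = b
      · have hne : c a ≠ 1 - b := by omega
        have e1 := hsum b (1 - b) (by omega)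
        rw [hab] at hmc
        have e3 := hins b
        have hyb : c y = b := by
          by_contra hyb
          rw [if_neg hyb] at e3
          omega
        rw [if_pos hyb] at e3
        refine ⟨1 - b, ?_, ?_⟩
        · rw [hcol _ hne]; omega
        · rw [hcol _ hne]; intro hlt; omega
      · have e1 := hsum b (1 - b) (by omega)
        have ha1 : c a = 1 - b := by omega
        rw [ha1] at hmc
        refine ⟨b, ?_, ?_⟩
        · rw [hcol _ hab]; omega
        · rw [hcol _ hab, hins]
          intro hlt x hx
          by_cases hxa : x = a
          · rwa [hxa]
          · apply hb' (by split_ifs at hlt <;> omega)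
            simp only [Finset.mem_sdiff, Finset.mem_union, Finset.mem_insert, Finset.mem_erase]
              at hx ⊢
            tauto

theorem Reach.balanced [DecidableEq α] {k : ℕ} (X : Finset α) (hX : 2 * k ≤ X.card)
    (A : Set (α → Fin 2)) :
    Reach (2 * k + 1) X.card (fun A => ∃ S ⊆ X, S.card = 2 * k ∧ ∀ c ∈ A,
      (∀ b, (S.filter fun x => c x = b).card = k) ∨ ∀ x ∈ X \ S, ∀ y ∈ X \ S, c x = c y) A := by
  obtain ⟨S₀, hS₀, hcard⟩ := Finset.exists_subset_card_eq hX
  have h := Reach.peel S₀ (X \ S₀) hcard Finset.disjoint_sdiff A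
  rw [Finset.union_sdiff_of_subset hS₀] at h
  refine (h.mono_time (Finset.card_le_card Finset.sdiff_subset)).imp
    fun A' _ ⟨S, hS, hSc, hb⟩ => ⟨S, hS, hSc, fun c hc => ?_⟩
  obtain ⟨b, hle, hlt⟩ := hb c hc
  have h01 := card_filter_color_add c S b (1 - b) (by omega)
  rcases hle.lt_or_eq with hl | he
  · refine Or.inr fun x hx y hy => ?_
    have := hlt hl x hx
    have := hlt hl y hy
    omega
  · refine Or.inl fun b' => ?_
    by_cases hbb : b' = b
    · rw [hbb, he]
    · have : b' = 1 - b := by omega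
      rw [this]; omega

/-! ### Bounded samples by Dickson's lemma -/

/-- Sets containing more than half of the balls of `W` can be tested on a sample `R` of bounded
size. -/
theorem exists_sample (N q : ℕ) : ∃ B : ℕ, ∀ (α : Type) [DecidableEq α] (W : Finset α)
    (G : Fin N → Finset α), Odd W.card → q ≤ W.card →
    (∀ i, W.card < 2 * (W ∩ G i).card) →
    ∃ R ⊆ W, R.card ≤ B ∧ q ≤ R.card ∧ Odd R.card ∧ ∀ i, R.card < 2 * (R ∩ G i).card := by
  classical
  let tot : ((Fin N → Bool) → ℕ) → ℕ := fun m => ∑ a, m a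
  -- Only the number of balls of each type matters, the type recording which `G i` contain the ball.
  let part : Fin N → ((Fin N → Bool) → ℕ) → ℕ := fun i m => ∑ a with a i = true, m a
  let V : Set ((Fin N → Bool) → ℕ) := {m | q ≤ tot m ∧ Odd (tot m) ∧ ∀ i, tot m < 2 * part i m}
  -- The minimal count vectors form an antichain in a finite power of `ℕ`; their largest total is a
  -- bound independent of `W`.
  have hfin : {m | Minimal (· ∈ V) m}.Finite :=
    WellQuasiOrderedLE.finite_of_isAntichain (setOfPred_minimal_antichain _)
  refine ⟨hfin.toFinset.sup tot, fun α _ W G hodd hq hG => ?_⟩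
  let ty : α → Fin N → Bool := fun x i => decide (x ∈ G i)
  have htot : ∀ (R : Finset α), tot (fun a => (R.filter fun x => ty x = a).card) = R.card :=
    fun R => (Finset.card_eq_sum_card_fiberwise (fun x _ => Finset.mem_univ (ty x))).symm
  have hpart : ∀ (R : Finset α) i,
      part i (fun a => (R.filter fun x => ty x = a).card) = (R ∩ G i).card := by
    intro R i
    have : ∀ x ∈ R ∩ G i, ty x ∈ Finset.univ.filter fun a : Fin N → Bool => a i = true := by
      intro x hx
      simpa [ty] using (Finset.mem_inter.1 hx).2
    rw [Finset.card_eq_sum_card_fiberwise this]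
    refine Finset.sum_congr rfl fun a ha => congrArg Finset.card ?_
    ext x
    simp only [Finset.mem_filter, Finset.mem_inter, Finset.mem_univ, true_and] at ha ⊢
    constructor
    · rintro ⟨hx, rfl⟩
      exact ⟨⟨hx, by simpa [ty] using ha⟩, rfl⟩
    · rintro ⟨⟨hx, -⟩, rfl⟩
      exact ⟨hx, rfl⟩
  let n : (Fin N → Bool) → ℕ := fun a => (W.filter fun x => ty x = a).card
  have hn : n ∈ V := ⟨by rwa [htot], by rwa [htot], fun i => by rw [htot, hpart]; exact hG i⟩
  obtain ⟨m, hmn, hm⟩ := exists_minimal_le_of_wellFoundedLT (· ∈ V) n hn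
  choose P hP hPc using fun a => Finset.exists_subset_card_eq (hmn a)
  let R : Finset α := Finset.univ.biUnion P
  have hR : (fun a => (R.filter fun x => ty x = a).card) = m := by
    funext a
    rw [← hPc a]
    congr 1
    ext x
    simp only [R, Finset.mem_filter, Finset.mem_biUnion, Finset.mem_univ, true_and]
    constructor
    · rintro ⟨⟨b, hb⟩, rfl⟩
      have := (Finset.mem_filter.1 (hP b hb)).2
      rwa [← this] at hb
    · intro hx
      exact ⟨⟨a, hx⟩, (Finset.mem_filter.1 (hP a hx)).2⟩
  have h1 := htot R
  have h2 := hpart R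
  rw [hR] at h1
  simp only [hR] at h2
  refine ⟨R, ?_, ?_, ?_, ?_, fun i => ?_⟩
  · intro x hx
    obtain ⟨a, -, ha⟩ := Finset.mem_biUnion.1 hx
    exact (Finset.mem_filter.1 (hP a ha)).1
  · rw [← h1]
    exact Finset.le_sup (f := tot) (hfin.mem_toFinset.2 hm)
  · rw [← h1]; exact hm.1.1
  · rw [← h1]; exact hm.1.2.1
  · rw [← h1, ← h2]; exact hm.1.2.2 i

/-! ### Partial knowledge of the colours -/

/-- Every colouring in `B` is constant on one of at most `N` sets, each containing more than half
of the balls of `W`. -/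
def Good (W : Finset α) (N : ℕ) (B : Set (α → Fin 2)) : Prop :=
  ∃ 𝒢 : Finset (Finset α), 𝒢.card ≤ N ∧ (∀ G ∈ 𝒢, G ⊆ W ∧ W.card < 2 * G.card) ∧
    ∀ c ∈ B, ∃ G ∈ 𝒢, ∀ x ∈ G, ∀ y ∈ G, c x = c y

/-- The colour of `x` is known to be at most that of `y`. -/
def Le (B : Set (α → Fin 2)) (x y : α) : Prop := ∀ c ∈ B, c x ≤ c y

theorem Le.trans {B : Set (α → Fin 2)} {x y z : α} (h : Le B x y) (h' : Le B y z) : Le B x z :=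
  fun c hc => (h c hc).trans (h' c hc)

theorem Le.refl (B : Set (α → Fin 2)) (x : α) : Le B x x := fun _ _ => le_rfl

theorem Le.anti {B B' : Set (α → Fin 2)} (hB : B' ⊆ B) {x y : α} (h : Le B x y) : Le B' x y :=
  fun c hc => h c (hB hc)

/-- The colour of `p` determines that of `z`. -/
def Det (B : Set (α → Fin 2)) (p z : α) : Prop := ∀ c ∈ B, ∀ d ∈ B, c p = d p → c z = d z

/-- The colour of `z` is known. -/
def Known (B : Set (α → Fin 2)) (z : α) : Prop := ∀ c ∈ B, ∀ d ∈ B, c z = d z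

open Classical in
/-- The number of balls of `W` of unknown colour. -/
noncomputable def unknown (W : Finset α) (B : Set (α → Fin 2)) : ℕ :=
  (W.filter fun z => ¬ Known B z).card

open Classical in
/-- The number of balls of `W` whose colour is not determined by that of `p`. -/
noncomputable def undet (W : Finset α) (p : α) (B : Set (α → Fin 2)) : ℕ :=
  (W.filter fun z => ¬ Det B p z).card

theorem undet_le_unknown (W : Finset α) (p : α) (B : Set (α → Fin 2)) :
    undet W p B ≤ unknown W B := by
  classical
  refine Finset.card_le_card fun z hz => ?_
  rw [Finset.mem_filter] at hz ⊢
  exact ⟨hz.1, fun h => hz.2 fun c hc c' hc' _ => h c hc c' hc'⟩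

/-- Once the colour of `p` is revealed, so are those of all balls that it determines. This refunds a
scan against `p`. -/
theorem unknown_le_undet {W : Finset α} {p : α} {B B' : Set (α → Fin 2)} (hB : B' ⊆ B)
    (hp : Known B' p) : unknown W B' ≤ undet W p B := by
  classical
  refine Finset.card_le_card fun z hz => ?_
  rw [Finset.mem_filter] at hz ⊢
  exact ⟨hz.1, fun h => hz.2 fun c hc c' hc' => h c (hB hc) c' (hB hc') (hp c hc c' hc')⟩

theorem undet_lt {W : Finset α} {p z : α} {B B' : Set (α → Fin 2)} (hB : B' ⊆ B)
    (hz : z ∈ W) (hzB : ¬ Det B p z) (hzB' : Det B' p z) : undet W p B' < undet W p B := by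
  classical
  refine Finset.card_lt_card ⟨fun x hx => ?_, fun hsub => ?_⟩
  · rw [Finset.mem_filter] at hx ⊢
    exact ⟨hx.1, fun h => hx.2 fun c hc c' hc' => h c (hB hc) c' (hB hc')⟩
  · have := hsub (Finset.mem_filter.2 ⟨hz, hzB⟩)
    exact (Finset.mem_filter.1 this).2 hzB'

theorem unknown_le_card (W : Finset α) (B : Set (α → Fin 2)) : unknown W B ≤ W.card := by
  classical
  exact Finset.card_filter_le _ _

theorem exists_color_majority {W : Finset α} (hW : Odd W.card) (c : α → Fin 2) :
    ∃ b, W.card < 2 * (W.filter fun x => c x = b).card := by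
  have h01 := card_filter_color_add c W 0 1 (by decide)
  obtain ⟨j, hj⟩ := hW
  by_contra hcon
  push Not at hcon
  have := hcon 0
  have := hcon 1
  omega

/-- If one ball determines all others, at most two colourings remain. -/
theorem good_of_det {W : Finset α} (hW : Odd W.card) {p : α} {B : Set (α → Fin 2)}
    (h : ∀ z ∈ W, Det B p z) : Good W 2 B := by
  classical
  have key : ∀ b : Fin 2, ∃ G ⊆ W, W.card < 2 * G.card ∧
      ∀ c ∈ B, c p = b → ∀ x ∈ G, ∀ y ∈ G, c x = c y := by
    intro b
    by_cases hb : ∃ c ∈ B, c p = b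
    · obtain ⟨c, hc, hcp⟩ := hb
      obtain ⟨d, hd⟩ := exists_color_majority hW c
      refine ⟨_, Finset.filter_subset _ _, hd, fun c' hc' hp x hx y hy => ?_⟩
      rw [Finset.mem_filter] at hx hy
      rw [h x hx.1 c' hc' c hc (hp.trans hcp.symm), h y hy.1 c' hc' c hc (hp.trans hcp.symm),
        hx.2, hy.2]
    · refine ⟨W, subset_rfl, ?_, fun c hc hcp => (hb ⟨c, hc, hcp⟩).elim⟩
      have := hW.pos
      omega
  choose G hG hGc hGB using key
  refine ⟨{G 0, G 1}, Finset.card_le_two, ?_, fun c hc => ⟨G (c p), ?_, hGB _ c hc rfl⟩⟩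
  · intro G' hG'
    rw [Finset.mem_insert, Finset.mem_singleton] at hG'
    rcases hG' with rfl | rfl
    · exact ⟨hG _, hGc _⟩
    · exact ⟨hG _, hGc _⟩
  · have : c p = 0 ∨ c p = 1 := by omega
    rcases this with h | h <;> simp [h]

/-! ### Comparisons and their amortised cost -/

/-- Comparing two balls with the help of a balanced set with known colours. -/
theorem Reach.compare [DecidableEq α] {k : ℕ} (hk : 1 ≤ k) {L H : Finset α} (hL : L.card = k)
    (hH : H.card = k) (hLH : Disjoint L H) {x y : α} (hx : x ∉ L ∪ H) (hy : y ∉ L ∪ H)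
    (hxy : x ≠ y) {B : Set (α → Fin 2)} (hB : ∀ c ∈ B, (∀ z ∈ L, c z = 0) ∧ ∀ z ∈ H, c z = 1) :
    Reach (2 * k + 1) 2 (fun B => Le B x y ∨ Le B y x ∨ ∀ c ∈ B, c x ≠ c y) B := by
  have hcount : ∀ (L' H' : Finset α), L' ⊆ L → H' ⊆ H → L'.card + H'.card + 2 = 2 * k + 1 →
      ((insert x (insert y (L' ∪ H'))).card = 2 * k + 1 ∧
      ∀ c ∈ B, ∀ a, Maj c (insert x (insert y (L' ∪ H'))) a →
        (c a = 1 ↔ k + 1 ≤ H'.card + (if c x = 1 then 1 else 0) + if c y = 1 then 1 else 0)) := by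
    intro L' H' hL' hH' hcard
    have hd : Disjoint L' H' := Disjoint.mono hL' hH' hLH
    have hy' : y ∉ L' ∪ H' := fun h => hy (Finset.union_subset_union hL' hH' h)
    have hx' : x ∉ insert y (L' ∪ H') := by
      rw [Finset.mem_insert, not_or]
      exact ⟨hxy, fun h => hx (Finset.union_subset_union hL' hH' h)⟩
    have h1 : (insert x (insert y (L' ∪ H'))).card = 2 * k + 1 := by
      rw [Finset.card_insert_of_notMem hx', Finset.card_insert_of_notMem hy',
        Finset.card_union_of_disjoint hd, ← hcard]
    refine ⟨h1, fun c hc a ha => ?_⟩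
    obtain ⟨hc0, hc1⟩ := hB c hc
    have hf : (L' ∪ H').filter (fun z => c z = 1) = H' := by
      ext z
      rw [Finset.mem_filter, Finset.mem_union]
      constructor
      · rintro ⟨h | h, hz⟩
        · have := hc0 z (hL' h); omega
        · exact h
      · exact fun h => ⟨Or.inr h, hc1 z (hH' h)⟩
    have hn : ((insert x (insert y (L' ∪ H'))).filter fun z => c z = 1).card =
        H'.card + (if c x = 1 then 1 else 0) + if c y = 1 then 1 else 0 := by
      rw [Finset.filter_insert, Finset.filter_insert, hf]
      have hyH : y ∉ H' := fun h => hy' (Finset.mem_union_right _ h)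
      have hxH : x ∉ H' := fun h => hx' (Finset.mem_insert_of_mem (Finset.mem_union_right _ h))
      split_ifs
      · rw [Finset.card_insert_of_notMem, Finset.card_insert_of_notMem hyH]
        rw [Finset.mem_insert, not_or]; exact ⟨hxy, hxH⟩
      · rw [Finset.card_insert_of_notMem hxH]
      · rw [Finset.card_insert_of_notMem hyH]
      · rfl
    rw [← hn]
    have h01 := card_filter_color_add c (insert x (insert y (L' ∪ H'))) 0 1 (by decide)
    constructor
    · intro h
      have := ha.2
      rw [h] at this
      omega
    · intro h
      exact ha.card_lt (by omega)
  obtain ⟨l, hl⟩ := Finset.card_pos.1 (show 0 < L.card by omega)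
  obtain ⟨h, hh⟩ := Finset.card_pos.1 (show 0 < H.card by omega)
  have hl' := Finset.card_erase_of_mem hl
  have hh' := Finset.card_erase_of_mem hh
  obtain ⟨hQ, h1⟩ := hcount L (H.erase h) subset_rfl (Finset.erase_subset _ _) (by omega)
  obtain ⟨hQ', h2⟩ := hcount (L.erase l) H (Finset.erase_subset _ _) subset_rfl (by omega)
  -- Omitting a ball of colour 1 tests whether `x` and `y` both have colour 1; omitting one of
  -- colour 0 tests whether at least one does. An answer `x` or `y` gives an inequality directly.
  refine Reach.ask (t := 1) _ hQ fun a ha => Reach.ask (t := 0) _ hQ' fun b hb => ?_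
  have f1 : ∀ c ∈ B, Maj c (insert x (insert y (L ∪ H.erase h))) a →
      (c a = 1 ↔ c x = 1 ∧ c y = 1) := by
    intro c hc hm
    rw [h1 c hc a hm]
    split_ifs <;> simp [*]
  have f2 : ∀ c ∈ B, Maj c (insert x (insert y (L.erase l ∪ H))) b →
      (c b = 1 ↔ c x = 1 ∨ c y = 1) := by
    intro c hc hm
    rw [h2 c hc b hm]
    split_ifs <;> simp [*]
  simp only [Finset.mem_insert, Finset.mem_union, Finset.mem_erase] at ha hb
  rcases ha with rfl | rfl | ha | ha
  · refine Or.inl fun c hc => ?_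
    have := f1 c hc.1.1 hc.1.2
    omega
  · refine Or.inr (Or.inl fun c hc => ?_)
    have := f1 c hc.1.1 hc.1.2
    omega
  · rcases hb with rfl | rfl | hb | hb
    · refine Or.inr (Or.inl fun c hc => ?_)
      have := f2 c hc.1.1 hc.2
      omega
    · refine Or.inl fun c hc => ?_
      have := f2 c hc.1.1 hc.2
      omega
    · refine Or.inl fun c hc => ?_
      have := f2 c hc.1.1 hc.2
      have := (hB c hc.1.1).1 b hb.2
      omega
    · refine Or.inr (Or.inr fun c hc => ?_)
      have := f1 c hc.1.1 hc.1.2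
      have := f2 c hc.1.1 hc.2
      have := (hB c hc.1.1).1 a ha
      have := (hB c hc.1.1).2 b hb
      omega
  · refine Or.inl fun c hc => ?_
    have := f1 c hc.1.1 hc.1.2
    have := (hB c hc.1.1).2 a ha.2
    omega

/-- `Reach` with amortised cost: the goal `Ψ` can be reached if it can be reached after `Φ`, where
four queries are free for each ball of `W` whose colour becomes known. -/
def Amort (q : ℕ) (W : Finset α) (Ψ : Set (α → Fin 2) → Prop) (t : ℕ)
    (Φ : Set (α → Fin 2) → Prop) (B : Set (α → Fin 2)) : Prop :=
  ∀ N, (∀ B' ⊆ B, Φ B' → Reach q (N + 4 * unknown W B') Ψ B') →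
    Reach q (N + t + 4 * unknown W B) Ψ B

/-- Three-way comparisons of balls of `W` cost two queries. -/
def Comparable3 (q : ℕ) (W : Finset α) (B : Set (α → Fin 2)) : Prop :=
  ∀ D ⊆ B, ∀ x ∈ W, ∀ y ∈ W, x ≠ y →
    Reach q 2 (fun B => Le B x y ∨ Le B y x ∨ ∀ c ∈ B, c x ≠ c y) D

/-- Two balls of different colours: compare all others with them, until their colours are known. -/
theorem Reach.scan {q : ℕ} {W : Finset α} (hW : Odd W.card) {B : Set (α → Fin 2)}
    (hcmp : Comparable3 q W B) {p p' : α} (hp : p ∈ W) (hp' : p' ∈ W)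
    (hne : ∀ c ∈ B, c p ≠ c p') {N : ℕ}
    (hcont : ∀ B' ⊆ B, Known B' p → Reach q (N + 4 * unknown W B') (Good W 2) B') :
    Reach q (N + 4 + 4 * undet W p B) (Good W 2) B := by
  induction hv : undet W p B using Nat.strong_induction_on generalizing B with
  | _ v ih =>
  subst hv
  by_cases hall : ∀ z ∈ W, Det B p z
  · exact Reach.of_holds (good_of_det hW hall)
  push Not at hall
  obtain ⟨z, hz, hdet⟩ := hall
  have hzp : z ≠ p := by rintro rfl; exact hdet fun c _ c' _ h => h
  have hzp' : z ≠ p' := by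
    rintro rfl
    refine hdet fun c hc c' hc' h => ?_
    have := hne c hc
    have := hne c' hc'
    omega
  have h2 : Reach q (2 + 2) (fun B' => (Le B' z p ∨ Le B' p z ∨ ∀ c ∈ B', c z ≠ c p) ∧
      (Le B' z p' ∨ Le B' p' z ∨ ∀ c ∈ B', c z ≠ c p')) B := by
    refine (hcmp B subset_rfl z hz p hp hzp).bind fun B₁ hB₁ h₁ => ?_
    refine (hcmp B₁ hB₁ z hz p' hp' hzp').imp fun B₂ hB₂ h₂ => ⟨?_, h₂⟩
    rcases h₁ with h | h | h
    · exact Or.inl (h.anti hB₂)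
    · exact Or.inr (Or.inl (h.anti hB₂))
    · exact Or.inr (Or.inr fun c hc => h c (hB₂ hc))
  have h3 : Reach q (2 + 2 + (N + 4 * undet W p B)) (Good W 2) B := by
    refine h2.bind fun B' hB' h => ?_
    -- As `p` and `p'` differ, a ball below both is 0 and one above both is 1; a ball between them
    -- reveals which of them is 0; a ball unequal to one of them equals the other.
    have hcase : Det B' p z ∨ Known B' p := by
      have hne' : ∀ c ∈ B', c p ≠ c p' := fun c hc => hne c (hB' hc)
      obtain ⟨h, h'⟩ := h
      rcases h with h | h | h
      · rcases h' with h' | h' | h'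
        · left; intro c hc c' hc' _
          have := h c hc; have := h' c hc; have := hne' c hc
          have := h c' hc'; have := h' c' hc'; have := hne' c' hc'
          omega
        · right; intro c hc c' hc'
          have := h c hc; have := h' c hc; have := hne' c hc
          have := h c' hc'; have := h' c' hc'; have := hne' c' hc'
          omega
        · left; intro c hc c' hc' _
          have := h' c hc; have := hne' c hc
          have := h' c' hc'; have := hne' c' hc'
          omega
      · rcases h' with h' | h' | h'
        · right; intro c hc c' hc'
          have := h c hc; have := h' c hc; have := hne' c hc
          have := h c' hc'; have := h' c' hc'; have := hne' c' hc'
          omega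
        · left; intro c hc c' hc' _
          have := h c hc; have := h' c hc; have := hne' c hc
          have := h c' hc'; have := h' c' hc'; have := hne' c' hc'
          omega
        · left; intro c hc c' hc' _
          have := h' c hc; have := hne' c hc
          have := h' c' hc'; have := hne' c' hc'
          omega
      · left; intro c hc c' hc' _
        have := h c hc
        have := h c' hc'
        omega
    rcases hcase with hd | hk
    · have hlt := undet_lt hB' hz hdet hd
      refine (ih _ hlt (fun B'' hB'' => hcmp B'' (hB''.trans hB'))
        (fun c hc => hne c (hB' hc)) (fun B'' hB'' => hcont B'' (hB''.trans hB')) rfl).mono_time ?_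
      omega
    -- The extra `4` in the bound pays for the comparisons of this last `z`.
    · refine (hcont B' hB' hk).mono_time ?_
      have := unknown_le_undet (W := W) hB' hk
      omega
  refine h3.mono_time (by omega)

/-- Two queries for the comparison and four for the overhead of a scan if the balls differ. The scan
either reaches the goal or reveals the colour of `x`, which settles the comparison. -/
theorem Amort.compare {q : ℕ} {W : Finset α} (hW : Odd W.card) {B : Set (α → Fin 2)}
    (hcmp : Comparable3 q W B) {x y : α} (hx : x ∈ W) (hy : y ∈ W) :
    Amort q W (Good W 2) 6 (fun B => Le B x y ∨ Le B y x) B := by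
  intro N hcont
  by_cases hxy : x = y
  · exact (hcont B subset_rfl (Or.inl (hxy ▸ Le.refl B x))).mono_time (by omega)
  have h : Reach q (2 + (N + 4 + 4 * unknown W B)) (Good W 2) B := by
    refine (hcmp B subset_rfl x hx y hy hxy).bind fun B' hB' h => ?_
    have hmono : unknown W B' ≤ unknown W B := by
      classical
      refine Finset.card_le_card fun z hz => ?_
      rw [Finset.mem_filter] at hz ⊢
      exact ⟨hz.1, fun h => hz.2 fun c hc c' hc' => h c (hB' hc) c' (hB' hc')⟩
    rcases h with h | h | h
    · exact (hcont B' hB' (Or.inl h)).mono_time (by omega)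
    · exact (hcont B' hB' (Or.inr h)).mono_time (by omega)
    · have hs := Reach.scan hW (fun B'' hB'' => hcmp B'' (hB''.trans hB')) hx hy h (N := N) ?_
      · refine hs.mono_time ?_
        have := undet_le_unknown W x B'
        omega
      · intro B'' hB'' hk
        refine hcont B'' (hB''.trans hB') ?_
        by_cases hle : Le B'' x y
        · exact Or.inl hle
        · right
          unfold Le at hle
          push Not at hle
          obtain ⟨c, hc, hlt⟩ := hle
          intro c' hc'
          have := hk c hc c' hc'
          omega
  exact h.mono_time (by omega)

namespace Amort

variable {q t t' : ℕ} {W : Finset α} {Φ Φ' Ψ : Set (α → Fin 2) → Prop} {B : Set (α → Fin 2)}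

theorem of_holds (h : Φ B) : Amort q W Ψ t Φ B :=
  fun N hN => (hN B subset_rfl h).mono_time (by omega)

theorem bind (h : Amort q W Ψ t Φ B) (h' : ∀ B' ⊆ B, Φ B' → Amort q W Ψ t' Φ' B') :
    Amort q W Ψ (t + t') Φ' B := by
  intro N hN
  refine (h (N + t') fun B' hB' hΦ => ?_).mono_time (by omega)
  exact h' B' hB' hΦ N fun B'' hB'' => hN B'' (hB''.trans hB')

theorem imp (h : Amort q W Ψ t Φ B) (h' : ∀ B' ⊆ B, Φ B' → Φ' B') : Amort q W Ψ t Φ' B :=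
  h.bind (t' := 0) fun B' hB' hΦ => of_holds (h' B' hB' hΦ)

theorem mono_time (h : Amort q W Ψ t Φ B) (ht : t ≤ t') : Amort q W Ψ t' Φ B :=
  fun N hN => (h N hN).mono_time (by omega)

theorem forall_mem {ι : Type} {I : Finset ι} {Φ : ι → Set (α → Fin 2) → Prop}
    (hΦ : ∀ i, Antitone (Φ i)) (h : ∀ i ∈ I, ∀ B' ⊆ B, Amort q W Ψ t (Φ i) B') :
    Amort q W Ψ (I.card * t) (fun B' => ∀ i ∈ I, Φ i B') B := by
  classical
  induction I using Finset.induction_on with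
  | empty => exact of_holds (by simp)
  | insert i I hi ih =>
    rw [Finset.card_insert_of_notMem hi, add_mul, one_mul]
    refine (ih fun j hj => h j (Finset.mem_insert_of_mem hj)).bind fun A' hA' hI => ?_
    refine (h i (Finset.mem_insert_self _ _) A' hA').imp fun B hB hiB j hj => ?_
    rcases Finset.mem_insert.1 hj with rfl | hj
    · exact hiB
    · exact hΦ j hB (hI j hj)

end Amort

theorem antitone_le_or (x y : α) : Antitone fun B : Set (α → Fin 2) => Le B x y ∨ Le B y x :=
  fun _ _ hB h => h.imp (Le.anti hB) (Le.anti hB)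

theorem Comparable3.anti {q : ℕ} {W : Finset α} {B B' : Set (α → Fin 2)} (hB : B' ⊆ B)
    (h : Comparable3 q W B) : Comparable3 q W B' :=
  fun B'' hB'' => h B'' (hB''.trans hB)

/-! ### Median-of-medians selection -/

open Classical in
/-- Some ball `o` of `Y` is known to have rank `r` (counted from zero). -/
def Selected (Y : Finset α) (r : ℕ) (B : Set (α → Fin 2)) : Prop :=
  ∃ o ∈ Y, r + 1 ≤ (Y.filter fun x => Le B x o).card ∧
    Y.card ≤ r + (Y.filter fun x => Le B o x).card

/-- Removing from `Y` the balls up to `m`. -/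
theorem Selected.of_above {Y Y' : Finset α} {r s : ℕ} {B : Set (α → Fin 2)} {m : α}
    (hY : Y' ⊆ Y) (hbelow : ∀ x ∈ Y, x ∉ Y' → Le B x m) (habove : ∀ x ∈ Y', Le B m x)
    (hs : r = s + (Y.card - Y'.card)) (h : Selected Y' s B) : Selected Y r B := by
  classical
  obtain ⟨o, ho, h1, h2⟩ := h
  refine ⟨o, hY ho, ?_, ?_⟩
  · have hsub : (Y'.filter fun x => Le B x o) ∪ (Y \ Y') ⊆ Y.filter fun x => Le B x o := by
      intro x hx
      rw [Finset.mem_union, Finset.mem_filter, Finset.mem_sdiff] at hx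
      rw [Finset.mem_filter]
      rcases hx with hx | hx
      · exact ⟨hY hx.1, hx.2⟩
      · exact ⟨hx.1, (hbelow x hx.1 hx.2).trans (habove o ho)⟩
    have hcard := Finset.card_le_card hsub
    rw [Finset.card_union_of_disjoint (Finset.disjoint_sdiff.mono_left (Finset.filter_subset _ _)),
      Finset.card_sdiff_of_subset hY] at hcard
    omega
  · have hsub : (Y'.filter fun x => Le B o x) ⊆ Y.filter fun x => Le B o x :=
      Finset.filter_subset_filter _ hY
    have := Finset.card_le_card hsub
    have := Finset.card_le_card hY
    omega

/-- Removing from `Y` the balls from `m` on. -/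
theorem Selected.of_below {Y Y' : Finset α} {r : ℕ} {B : Set (α → Fin 2)} {m : α}
    (hY : Y' ⊆ Y) (habove : ∀ x ∈ Y, x ∉ Y' → Le B m x) (hbelow : ∀ x ∈ Y', Le B x m)
    (h : Selected Y' r B) : Selected Y r B := by
  classical
  obtain ⟨o, ho, h1, h2⟩ := h
  refine ⟨o, hY ho, ?_, ?_⟩
  · have hsub : (Y'.filter fun x => Le B x o) ⊆ Y.filter fun x => Le B x o :=
      Finset.filter_subset_filter _ hY
    have := Finset.card_le_card hsub
    omega
  · have hsub : (Y'.filter fun x => Le B o x) ∪ (Y \ Y') ⊆ Y.filter fun x => Le B o x := by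
      intro x hx
      rw [Finset.mem_union, Finset.mem_filter, Finset.mem_sdiff] at hx
      rw [Finset.mem_filter]
      rcases hx with hx | hx
      · exact ⟨hY hx.1, hx.2⟩
      · exact ⟨hx.1, (hbelow o ho).trans (habove x hx.1 hx.2)⟩
    have hcard := Finset.card_le_card hsub
    rw [Finset.card_union_of_disjoint (Finset.disjoint_sdiff.mono_left (Finset.filter_subset _ _)),
      Finset.card_sdiff_of_subset hY] at hcard
    have := Finset.card_le_card hY
    omega

/-- One step of selection by a pivot `m`. -/
theorem selected_or_of_pivot {Y : Finset α} {r : ℕ} (hr : r < Y.card) {B : Set (α → Fin 2)} {m : α}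
    (hm : m ∈ Y) (htot : ∀ x ∈ Y, Le B x m ∨ Le B m x) {j : ℕ}
    (hlo : ∃ Z ⊆ Y, j ≤ Z.card ∧ ∀ z ∈ Z, Le B z m)
    (hhi : ∃ Z ⊆ Y, j ≤ Z.card ∧ ∀ z ∈ Z, Le B m z) :
    Selected Y r B ∨ ∃ Y' ⊆ Y, ∃ s < Y'.card, Y'.card + j ≤ Y.card ∧
      ∀ B' ⊆ B, Selected Y' s B' → Selected Y r B' := by
  classical
  have hlo' : j ≤ (Y.filter fun x => Le B x m).card := by
    obtain ⟨Z, hZ, hj, hZm⟩ := hlo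
    exact hj.trans (Finset.card_le_card fun z hz => Finset.mem_filter.2 ⟨hZ hz, hZm z hz⟩)
  have hhi' : j ≤ (Y.filter fun x => Le B m x).card := by
    obtain ⟨Z, hZ, hj, hZm⟩ := hhi
    exact hj.trans (Finset.card_le_card fun z hz => Finset.mem_filter.2 ⟨hZ hz, hZm z hz⟩)
  by_cases h1 : r + 1 ≤ (Y.filter fun x => Le B x m).card
  · by_cases h2 : Y.card ≤ r + (Y.filter fun x => Le B m x).card
    · exact Or.inl ⟨m, hm, h1, h2⟩
    · right
      have hc := Finset.card_filter_add_card_filter_not (s := Y) (fun x => Le B m x)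
      refine ⟨Y.filter fun x => ¬ Le B m x, Finset.filter_subset _ _, r, by omega, by omega,
        fun B' hB' => Selected.of_below (m := m) (Finset.filter_subset _ _) ?_ ?_⟩
      · intro x hx hx'
        rw [Finset.mem_filter, not_and_not_right] at hx'
        exact (hx' hx).anti hB'
      · intro x hx
        rw [Finset.mem_filter] at hx
        exact ((htot x hx.1).resolve_right hx.2).anti hB'
  · right
    have hc := Finset.card_filter_add_card_filter_not (s := Y) (fun x => Le B x m)
    refine ⟨Y.filter fun x => ¬ Le B x m, Finset.filter_subset _ _,
      r - (Y.filter fun x => Le B x m).card, by omega, by omega,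
      fun B' hB' => Selected.of_above (m := m) (Finset.filter_subset _ _) ?_ ?_ (by omega)⟩
    · intro x hx hx'
      rw [Finset.mem_filter, not_and_not_right] at hx'
      exact (hx' hx).anti hB'
    · intro x hx
      rw [Finset.mem_filter] at hx
      exact ((htot x hx.1).resolve_left hx.2).anti hB'

theorem selected_of_total {Y : Finset α} {r : ℕ} (hr : r < Y.card) {B : Set (α → Fin 2)}
    (htot : ∀ x ∈ Y, ∀ y ∈ Y, Le B x y ∨ Le B y x) : Selected Y r B := by
  classical
  induction hn : Y.card using Nat.strong_induction_on generalizing Y r with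
  | _ n ih =>
  subst hn
  obtain ⟨m, hm⟩ := Finset.card_pos.1 (show 0 < Y.card by omega)
  have hself : ∃ Z ⊆ Y, 1 ≤ Z.card ∧ ∀ z ∈ Z, Le B z m ∧ Le B m z :=
    ⟨{m}, by simpa using hm, by simp, by simp [Le.refl]⟩
  obtain ⟨Z, hZ, hc, hZm⟩ := hself
  rcases selected_or_of_pivot hr hm (fun x hx => htot x hx m hm)
    ⟨Z, hZ, hc, fun z hz => (hZm z hz).1⟩ ⟨Z, hZ, hc, fun z hz => (hZm z hz).2⟩ with
    h | ⟨Y', hY', s, hs, hc', h⟩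
  · exact h
  · exact h B subset_rfl (ih Y'.card (by omega) hs
      (fun x hx y hy => htot x (hY' hx) y (hY' hy)) rfl)

/-- Comparing all pairs. -/
theorem Amort.total {q : ℕ} {W : Finset α} (hW : Odd W.card) {B : Set (α → Fin 2)}
    (hcmp : Comparable3 q W B) {Y : Finset α} (hY : Y ⊆ W) :
    Amort q W (Good W 2) (Y.card * Y.card * 6)
      (fun B => ∀ x ∈ Y, ∀ y ∈ Y, Le B x y ∨ Le B y x) B := by
  rw [← Finset.card_product]
  refine (Amort.forall_mem (I := Y ×ˢ Y) (Φ := fun p B => Le B p.1 p.2 ∨ Le B p.2 p.1)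
    (fun p => antitone_le_or _ _) fun p hp B' hB' => ?_).imp fun B' _ h x hx y hy =>
      h (x, y) (Finset.mk_mem_product hx hy)
  rw [Finset.mem_product] at hp
  exact Amort.compare hW (hcmp.anti hB') (hY hp.1) (hY hp.2)

/-- Any `i` balls of `M` have at least `3 * i` balls of `Y` below them, and as many above them. -/
def Spread (Y M : Finset α) (B : Set (α → Fin 2)) : Prop :=
  ∀ P ⊆ M, (∃ Z ⊆ Y, 3 * P.card ≤ Z.card ∧ ∀ z ∈ Z, ∃ m ∈ P, Le B z m) ∧
    ∃ Z ⊆ Y, 3 * P.card ≤ Z.card ∧ ∀ z ∈ Z, ∃ m ∈ P, Le B m z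

/-- The medians of groups of five. -/
theorem Amort.medians {q : ℕ} {W : Finset α} (hW : Odd W.card) (i : ℕ) {B : Set (α → Fin 2)}
    (hcmp : Comparable3 q W B) {Y : Finset α} (hY : Y ⊆ W) (hi : 5 * i ≤ Y.card) :
    Amort q W (Good W 2) (150 * i) (fun B => ∃ M ⊆ Y, M.card = i ∧ Spread Y M B) B := by
  classical
  induction i generalizing B Y with
  | zero =>
    refine Amort.of_holds ⟨∅, by simp, by simp, fun M' hM' => ?_⟩
    rw [Finset.subset_empty] at hM'
    subst hM'
    exact ⟨⟨∅, by simp⟩, ⟨∅, by simp⟩⟩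
  | succ i ih =>
    obtain ⟨G, hG, hGc⟩ := Finset.exists_subset_card_eq (show 5 ≤ Y.card by omega)
    have hYG := Finset.card_sdiff_of_subset hG
    have htot := Amort.total hW hcmp (hG.trans hY)
    rw [hGc] at htot
    rw [mul_add, add_comm]
    -- Sorting a group costs `5 * 5 * 6 = 150`.
    refine Amort.bind htot fun B₁ hB₁ h₁ => ?_
    refine (ih (hcmp.anti hB₁) (Finset.sdiff_subset.trans hY)
      (show 5 * i ≤ (Y \ G).card by omega)).imp
      fun B₂ hB₂ ⟨M, hM, hMc, hS⟩ => ?_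
    obtain ⟨o, ho, h2, h3⟩ := selected_of_total (r := 2) (by omega)
      fun x hx y hy => antitone_le_or x y hB₂ (h₁ x hx y hy)
    have hoM : o ∉ M := fun h => (Finset.mem_sdiff.1 (hM h)).2 ho
    have hstep : ∀ (R : α → α → Prop) (M' : Finset α), M' ⊆ insert o M →
        3 ≤ (G.filter fun x => R x o).card →
        (∃ Z ⊆ Y \ G, 3 * (M'.erase o).card ≤ Z.card ∧ ∀ z ∈ Z, ∃ m ∈ M'.erase o, R z m) →
        ∃ Z ⊆ Y, 3 * M'.card ≤ Z.card ∧ ∀ z ∈ Z, ∃ m ∈ M', R z m := by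
      rintro R M' hM' hR ⟨Z, hZ, hZc, hZR⟩
      by_cases hoM' : o ∈ M'
      · refine ⟨Z ∪ G.filter fun x => R x o, ?_, ?_, ?_⟩
        · exact Finset.union_subset (hZ.trans Finset.sdiff_subset)
            ((Finset.filter_subset _ _).trans hG)
        · rw [Finset.card_union_of_disjoint
            (Finset.sdiff_disjoint.mono hZ (Finset.filter_subset _ _))]
          rw [Finset.card_erase_of_mem hoM'] at hZc
          omega
        · intro z hz
          rcases Finset.mem_union.1 hz with hz | hz
          · obtain ⟨m, hm, h⟩ := hZR z hz
            exact ⟨m, Finset.mem_of_mem_erase hm, h⟩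
          · exact ⟨o, hoM', (Finset.mem_filter.1 hz).2⟩
      · rw [Finset.erase_eq_of_notMem hoM'] at hZc hZR
        exact ⟨Z, hZ.trans Finset.sdiff_subset, hZc, hZR⟩
    refine ⟨insert o M, Finset.insert_subset (hG ho) (hM.trans Finset.sdiff_subset), ?_,
      fun M' hM' => ?_⟩
    · rw [Finset.card_insert_of_notMem hoM, hMc]
    · obtain ⟨h4, h5⟩ := hS (M'.erase o) (Finset.subset_insert_iff.1 hM')
      exact ⟨hstep (Le B₂) M' hM' h2 h4, hstep (fun x y => Le B₂ y x) M' hM' (by omega) h5⟩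

/-- Selection in linear time. -/
theorem Amort.select {q : ℕ} {W : Finset α} (hW : Odd W.card) {B : Set (α → Fin 2)}
    (hcmp : Comparable3 q W B) {Y : Finset α} (hY : Y ⊆ W) {r : ℕ} (hr : r < Y.card) :
    Amort q W (Good W 2) (648 * Y.card) (Selected Y r) B := by
  classical
  induction hn : Y.card using Nat.strong_induction_on generalizing Y r B with
  | _ n ih =>
  subst hn
  by_cases hsmall : Y.card < 5
  · refine ((Amort.total hW hcmp hY).mono_time ?_).imp fun B' _ h => selected_of_total hr h
    nlinarith
  obtain ⟨j, hj⟩ : ∃ j, j = Y.card / 5 := ⟨_, rfl⟩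
  have hmed := Amort.medians hW j hcmp hY (by omega)
  -- The summands are for the group medians, their median `m`, the comparisons of all of `Y` with
  -- `m`, and the recursion on what remains.
  have hall : Amort q W (Good W 2) (150 * j + (648 * j + (6 * Y.card +
      648 * (Y.card - (3 * j + 1) / 2)))) (Selected Y r) B := by
    refine hmed.bind fun B₁ hB₁ ⟨M, hM, hMc, hS⟩ => ?_
    have hrec := ih M.card (by omega) (hcmp.anti hB₁) (hM.trans hY)
      (show (j / 2) < M.card by omega) rfl
    rw [hMc] at hrec
    refine hrec.bind fun B₂ hB₂ ⟨m, hm, hlo, hhi⟩ => ?_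
    have hpart : Amort q W (Good W 2) (Y.card * 6)
        (fun B => ∀ x ∈ Y, Le B x m ∨ Le B m x) B₂ :=
      Amort.forall_mem (fun x => antitone_le_or x m) fun x hx B' hB' =>
        Amort.compare hW (hcmp.anti ((hB'.trans hB₂).trans hB₁)) (hY hx) (hY (hM hm))
    rw [mul_comm 6]
    refine hpart.bind fun B₃ hB₃ htot => ?_
    -- At least `j / 2` (rounded up) of the medians lie on each side of `m`, itself included, and
    -- each brings three balls of its own group.
    have hpiv := selected_or_of_pivot (j := (3 * j + 1) / 2) hr (hM hm) htot ?_ ?_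
    · rcases hpiv with h | ⟨Y', hY', s, hs, hc, h⟩
      · exact Amort.of_holds h
      · refine ((ih Y'.card (by omega) (hcmp.anti ((hB₃.trans hB₂).trans hB₁)) (hY'.trans hY) hs
          rfl).imp h).mono_time (by omega)
    · obtain ⟨Z, hZ, hZc, hZm⟩ := (hS _ (Finset.filter_subset (fun x => Le B₂ x m) M)).1
      refine ⟨Z, hZ, ?_, fun z hz => ?_⟩
      · refine le_trans ?_ hZc
        have hlo' : j / 2 + 1 ≤ (M.filter fun x => Le B₂ x m).card := hlo
        omega
      · obtain ⟨y, hy, hle⟩ := hZm z hz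
        exact (hle.anti (hB₃.trans hB₂)).trans ((Finset.mem_filter.1 hy).2.anti hB₃)
    · obtain ⟨Z, hZ, hZc, hZm⟩ := (hS _ (Finset.filter_subset (fun x => Le B₂ m x) M)).2
      refine ⟨Z, hZ, ?_, fun z hz => ?_⟩
      · refine le_trans ?_ hZc
        have hhi' : M.card ≤ j / 2 + (M.filter fun x => Le B₂ m x).card := hhi
        omega
      · obtain ⟨y, hy, hle⟩ := hZm z hz
        exact ((Finset.mem_filter.1 hy).2.anti hB₃).trans (hle.anti (hB₃.trans hB₂))
  exact hall.mono_time (by omega)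

/-- The median of `W` is found in linear time. -/
theorem Reach.good_two {q : ℕ} {W : Finset α} (hW : Odd W.card) {B : Set (α → Fin 2)}
    (hcmp : Comparable3 q W B) : Reach q (652 * W.card) (Good W 2) B := by
  classical
  obtain ⟨r, hr⟩ := hW
  have h := Amort.select ⟨r, hr⟩ hcmp subset_rfl (show r < W.card by omega) 0 fun B' _ h => ?_
  · refine h.mono_time ?_
    have := unknown_le_card W B
    omega
  · refine Reach.of_holds ?_
    obtain ⟨o, ho, h1, h2⟩ := h
    -- If the median `o` has colour 0, so has all below it; if 1, so has all above it.
    refine ⟨{W.filter fun x => Le B' x o, W.filter fun x => Le B' o x}, Finset.card_le_two, ?_,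
      fun c hc => ?_⟩
    · intro G hG
      rw [Finset.mem_insert, Finset.mem_singleton] at hG
      rcases hG with rfl | rfl
      · have h1' : r + 1 ≤ (W.filter fun x => Le B' x o).card := h1
        exact ⟨Finset.filter_subset _ _, by omega⟩
      · have h2' : W.card ≤ r + (W.filter fun x => Le B' o x).card := h2
        exact ⟨Finset.filter_subset _ _, by omega⟩
    · have hco : c o = 0 ∨ c o = 1 := by omega
      rcases hco with h0 | h0
      · refine ⟨W.filter fun x => Le B' x o, by simp, fun x hx y hy => ?_⟩
        have := (Finset.mem_filter.1 hx).2 c hc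
        have := (Finset.mem_filter.1 hy).2 c hc
        omega
      · refine ⟨W.filter fun x => Le B' o x, by simp, fun x hx y hy => ?_⟩
        have := (Finset.mem_filter.1 hx).2 c hc
        have := (Finset.mem_filter.1 hy).2 c hc
        omega

/-! ### Trying all balanced colourings of the reference set -/

theorem Good.anti {W : Finset α} {N : ℕ} : Antitone (Good W N) := by
  rintro B B' hB ⟨𝒢, h1, h2, h3⟩
  exact ⟨𝒢, h1, h2, fun c hc => h3 c (hB hc)⟩

/-- The colourings that are `1` on `H` and `0` on the rest of `S`. -/
def splitSet [DecidableEq α] (S H : Finset α) : Set (α → Fin 2) :=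
  {c | (∀ z ∈ S \ H, c z = 0) ∧ ∀ z ∈ H, c z = 1}

theorem Comparable3.of_split [DecidableEq α] {k : ℕ} (hk : 1 ≤ k) {S H X : Finset α}
    (hS : S.card = 2 * k) (hH : H ⊆ S) (hHc : H.card = k) (A : Set (α → Fin 2)) :
    Comparable3 (2 * k + 1) (X \ S) (A ∩ splitSet S H) := by
  intro B hB x hx y hy hxy
  have hu : S \ H ∪ H = S := Finset.sdiff_union_of_subset hH
  refine Reach.compare hk (L := S \ H) (H := H) ?_ hHc Finset.sdiff_disjoint ?_ ?_ hxy
    fun c hc => (hB hc).2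
  · rw [Finset.card_sdiff_of_subset hH]; omega
  · rw [hu]; exact (Finset.mem_sdiff.1 hx).2
  · rw [hu]; exact (Finset.mem_sdiff.1 hy).2

/-- If `S` is balanced or all other balls have the same colour, then trying all colourings of `S`
leads to a bounded number of sets as in `Good`. -/
theorem Reach.good [DecidableEq α] {k : ℕ} (hk : 1 ≤ k) {S X : Finset α} (hS : S.card = 2 * k)
    (hW : Odd (X \ S).card) {A : Set (α → Fin 2)}
    (hA : ∀ c ∈ A, (∀ b, (S.filter fun x => c x = b).card = k) ∨
      ∀ x ∈ X \ S, ∀ y ∈ X \ S, c x = c y) :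
    Reach (2 * k + 1) ((2 * k).choose k * (652 * (X \ S).card))
      (Good (X \ S) ((2 * k).choose k * 2 + 1)) A := by
  have hcard : (S.powersetCard k).card = (2 * k).choose k := by
    rw [Finset.card_powersetCard, hS]
  have h := Reach.forall_mem (q := 2 * k + 1) (A := A) (t := 652 * (X \ S).card)
    (I := S.powersetCard k) (Φ := fun H A => Good (X \ S) 2 (A ∩ splitSet S H))
    (fun H A A' hA h => Good.anti (Set.inter_subset_inter_left _ hA) h) fun H hH A' _ => by
      rw [Finset.mem_powersetCard] at hH
      exact Reach.restrict (Reach.good_two hW (Comparable3.of_split hk hS hH.1 hH.2 A'))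
  rw [hcard] at h
  refine h.imp fun A' hA' hgood => ?_
  choose! 𝒢 h𝒢 hG hc using hgood
  -- The additional set `X \ S` serves the colourings for which no guess is right.
  refine ⟨insert (X \ S) ((S.powersetCard k).biUnion 𝒢), ?_, ?_, fun c hcA => ?_⟩
  · refine (Finset.card_insert_le _ _).trans (Nat.succ_le_succ ?_)
    rw [← hcard]
    exact Finset.card_biUnion_le_card_mul _ _ _ h𝒢
  · intro G hGm
    rw [Finset.mem_insert, Finset.mem_biUnion] at hGm
    rcases hGm with rfl | ⟨H, hH, hGH⟩
    · exact ⟨subset_rfl, by have := hW.pos; omega⟩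
    · exact hG H hH G hGH
  · rcases hA c (hA' hcA) with hb | hconst
    · have hH : (S.filter fun x => c x = 1) ∈ S.powersetCard k :=
        Finset.mem_powersetCard.2 ⟨Finset.filter_subset _ _, hb 1⟩
      have h0 : ∀ z ∈ S \ S.filter fun x => c x = 1, c z = 0 := by
        intro z hz
        rw [Finset.mem_sdiff, Finset.mem_filter] at hz
        have : c z ≠ 1 := fun h => hz.2 ⟨hz.1, h⟩
        omega
      obtain ⟨G, hGm, hGc⟩ := hc _ hH c ⟨hcA, h0, fun z hz => (Finset.mem_filter.1 hz).2⟩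
      exact ⟨G, Finset.mem_insert_of_mem (Finset.mem_biUnion.2 ⟨_, hH, hGm⟩), hGc⟩
    · exact ⟨_, Finset.mem_insert_self _ _, hconst⟩

/-! ### Assembling the algorithm -/

/-- A majority ball of a set with an odd number of balls is found in linear time. -/
theorem Reach.exists_maj {k : ℕ} (hk : 1 ≤ k) : ∃ K : ℕ, ∀ (α : Type) [DecidableEq α]
    (X : Finset α), Odd X.card → 4 * k + 1 ≤ X.card → ∀ A : Set (α → Fin 2),
    Reach (2 * k + 1) (K * X.card)
      (fun A => ∃ x ∈ X, ∀ c ∈ A, X.card < 2 * (X.filter fun y => c y = c x).card) A := by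
  obtain ⟨D, hD⟩ := exists_sample ((2 * k).choose k * 2 + 1) (2 * k + 1)
  refine ⟨1 + ((2 * k).choose k * 652 + (Finset.range (D + 1)).sup (majCost k)),
    fun α _ X hodd hX A => ?_⟩
  have hmain : Reach (2 * k + 1) (X.card + ((2 * k).choose k * (652 * X.card) +
      (Finset.range (D + 1)).sup (majCost k)))
      (fun A => ∃ x ∈ X, ∀ c ∈ A, X.card < 2 * (X.filter fun y => c y = c x).card) A := by
    refine (Reach.balanced X (by omega) A).bind fun A₁ _ ⟨S, hS, hSc, hbal⟩ => ?_
    have hWc := Finset.card_sdiff_of_subset hS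
    have hW : Odd (X \ S).card := by
      rw [hWc, hSc]
      obtain ⟨r, hr⟩ := hodd
      exact ⟨r - k, by omega⟩
    have hgood := (Reach.good hk hSc hW hbal).mono_time
      (Nat.mul_le_mul_left _ (Nat.mul_le_mul_left 652 (show (X \ S).card ≤ X.card by omega)))
    refine hgood.bind fun A₂ hA₂ ⟨𝒢, h𝒢, hG, hconst⟩ => ?_
    -- The family is padded with `X \ S` to the fixed length that `exists_sample` expects.
    let g : Fin ((2 * k).choose k * 2 + 1) → Finset α := fun i =>
      if h : (i : ℕ) < 𝒢.card then (𝒢.equivFin.symm ⟨i, h⟩ : Finset α) else X \ S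
    have hg : ∀ G ∈ 𝒢, ∃ i, g i = G := by
      intro G hGm
      have hlt := (𝒢.equivFin ⟨G, hGm⟩).2
      refine ⟨⟨𝒢.equivFin ⟨G, hGm⟩, by omega⟩, ?_⟩
      simp [g]
    obtain ⟨R, hR, hRD, hRq, hRodd, hRG⟩ := hD α (X \ S) g hW (by omega) fun i => by
      have hi : g i ⊆ X \ S ∧ (X \ S).card < 2 * (g i).card := by
        by_cases h : (i : ℕ) < 𝒢.card
        · simp only [g, h, dif_pos]
          exact hG _ (Subtype.property _)
        · simp only [g, h, dif_neg, not_false_eq_true]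
          exact ⟨subset_rfl, by have := hW.pos; omega⟩
      rw [Finset.inter_eq_right.2 hi.1]
      exact hi.2
    obtain ⟨j, hj⟩ := hRodd
    have hcost : majCost k (j - k) ≤ (Finset.range (D + 1)).sup (majCost k) :=
      Finset.le_sup (f := majCost k) (Finset.mem_range.2 (by omega))
    refine ((Reach.maj hk (j - k) R (by omega) A₂).mono_time hcost).imp
      fun A₃ hA₃ ⟨x, hx, hmaj⟩ => ⟨x, (Finset.mem_sdiff.1 (hR hx)).1, fun c hc => ?_⟩
    obtain ⟨G, hGm, hGc⟩ := hconst c (hA₃ hc)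
    obtain ⟨i, hi⟩ := hg G hGm
    have hRi := hRG i
    rw [hi] at hRi
    obtain ⟨y, hy⟩ := Finset.card_pos.1 (show 0 < (R ∩ G).card by omega)
    have hyG := (Finset.mem_inter.1 hy).2
    have hxy : c x = c y := by
      refine (hmaj c hc).card_lt (lt_of_lt_of_le hRi (Nat.mul_le_mul_left 2 ?_))
      refine Finset.card_le_card fun z hz => ?_
      rw [Finset.mem_inter] at hz
      exact Finset.mem_filter.2 ⟨hz.1, hGc z hz.2 y hyG⟩
    have hWmaj : G.card ≤ ((X \ S).filter fun z => c z = c x).card :=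
      Finset.card_le_card fun z hz =>
        Finset.mem_filter.2 ⟨(hG G hGm).1 hz, (hGc z hz y hyG).trans hxy.symm⟩
    have hGW := (hG G hGm).2
    have hsplit : (X.filter fun z => c z = c x).card =
        ((X \ S).filter fun z => c z = c x).card + (S.filter fun z => c z = c x).card := by
      rw [← Finset.card_union_of_disjoint (Finset.disjoint_filter_filter Finset.sdiff_disjoint),
        ← Finset.filter_union, Finset.sdiff_union_of_subset hS]
    -- A balanced `S` does not disturb the majority of `X \ S`; otherwise `X \ S` is monochromatic
    -- and, as `4 * k + 1 ≤ X.card`, larger than `S`.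
    rcases hbal c (hA₂ (hA₃ hc)) with hb | hcon
    · have := hb (c x)
      omega
    · have : (X \ S).filter (fun z => c z = c x) = X \ S :=
        Finset.filter_true_of_mem fun z hz => hcon z hz x (hR hx)
      rw [this] at hsplit
      omega
  refine hmain.mono_time ?_
  have := Nat.le_mul_of_pos_right ((Finset.range (D + 1)).sup (majCost k))
    (show 0 < X.card by omega)
  linarith [add_mul 1 ((2 * k).choose k * 652 + (Finset.range (D + 1)).sup (majCost k)) X.card,
    add_mul ((2 * k).choose k * 652) ((Finset.range (D + 1)).sup (majCost k)) X.card,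
    mul_assoc ((2 * k).choose k) 652 X.card]

/-- For even `n` one ball is ignored: more than half of `n - 1` balls are at least `n / 2`. -/
theorem exists_solvableWithin {k : ℕ} (hk : 1 ≤ k) :
    ∃ K : ℕ, ∀ n : ℕ, 4 * k + 2 ≤ n → SolvableWithin n (2 * k + 1) 2 (K * n) := by
  obtain ⟨K, hK⟩ := Reach.exists_maj hk
  refine ⟨K, fun n hn => ?_⟩
  obtain ⟨X, hodd, hX⟩ : ∃ X : Finset (Fin n), Odd X.card ∧ n ≤ X.card + 1 := by
    rcases Nat.even_or_odd' n with ⟨j, hj | hj⟩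
    · refine ⟨Finset.univ.erase ⟨0, by omega⟩, ?_⟩
      rw [Finset.card_erase_of_mem (Finset.mem_univ _), Finset.card_univ, Fintype.card_fin]
      exact ⟨⟨j - 1, by omega⟩, by omega⟩
    · refine ⟨Finset.univ, ?_⟩
      rw [Finset.card_univ, Fintype.card_fin]
      exact ⟨⟨j, hj⟩, by omega⟩
  have hXn : X.card ≤ n := by simpa using Finset.card_le_univ X
  have h := ((hK (Fin n) X hodd (by omega) Set.univ).mono_time (Nat.mul_le_mul_left K hXn)).imp
    (Ψ := fun A => ∃ x, ∀ c ∈ A, IsNonMinorityBall c Finset.univ x) fun A' _ ⟨x, _, hx⟩ =>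
      ⟨x, fun c hc => ⟨Finset.mem_univ x, ?_⟩⟩
  · obtain ⟨s, hs, hrun⟩ := h.exists_strategy ⟨k, rfl⟩
    exact ⟨s, hs, fun c m r hr => hrun c trivial m r hr⟩
  · have h1 := hx c hc
    have h2 : (X.filter fun y => c y = c x).card ≤ colorCount c Finset.univ x :=
      Finset.card_le_card (Finset.filter_subset_filter _ (Finset.subset_univ X))
    rw [div_le_iff₀ (by norm_num), Finset.card_univ, Fintype.card_fin]
    exact_mod_cast (show n ≤ colorCount c Finset.univ x * 2 by omega)

end MajorityProblem

theorem mainTheorem2 (k : ℕ) (hk : 1 ≤ k) :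
    ∃ K n₀ : ℕ, ∀ n : ℕ, n₀ ≤ n →
      MajorityProblem.MB n (2 * k + 1) 2 ≤ (K : ℕ∞) * (n : ℕ∞) := by
  obtain ⟨K, hK⟩ := MajorityProblem.exists_solvableWithin hk
  refine ⟨K, 4 * k + 2, fun n hn => ?_⟩
  refine (iInf₂_le (K * n) (hK n hn)).trans ?_
  push_cast
  exact le_rfl
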